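/- A metrisable space $X$ is an absolute neighbourhood retract (ANR) if, for every homeomorphism $h$ of $X$ onto a closed subset $h(X)$ of a metrisable space $Y$, some open neighbourhood $U$ of $h(X)$ in $Y$ retracts onto $h(X)$. For a continuous map $q\colon X\to Y$, the sectional category $\mathrm{secat}(q)$ is the smallest integer $k\ge 0$ such that $Y$ has an open cover $Y=U_0\cup\dots\cup U_k$ with $q$ admitting a continuous section over each $U_i$. The generalised sectional category $\mathrm{secat}_g(q)$ is the smallest $k\ge 0$ such that there is a partition $Y=A_0\sqcup\dots\sqcup A_k$ into arbitrary pairwise disjoint (possibly empty) subsets with $q$ admitting a continuous section over each $A_i$. Each number is $\infty$ if no such $k$ exists. For a continuous map $p\colon E\to B$ let $E\times_B E=\{(e,e')\in E\times E: p(e)=p(e')\}$, let $E_B^I$ be the space of continuous paths $\gamma\colon[0,1]\to E$ with $p\circ\gamma$ constant (compact-open topology), let $\Pi\colon E_B^I\to E\times_B E$ be given by $\Pi(\gamma)=(\gamma(0),\gamma(1))$, and define the parametrised topological complexity $\mathrm{TC}[p\colon E\to B]=\mathrm{secat}(\Pi)$. **Proposition.** Let $p\colon E\to B$ be a locally trivial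 fibration (every $b\in B$ has an open neighbourhood $V$ over which $p$ is homeomorphic to the projection $V\times p^{-1}(b)\to V$), where $E$ and $B$ are metrisable separable ANRs. Then $$\mathrm{TC}[p\colon E\to B]=\mathrm{secat}_g(\Pi\colon E_B^I\to E\times_B E),$$ and both numbers are equal to the smallest integer $k\ge 0$ (or $\infty$ if there is none) such that $E\times_B E$ is a union of $k+1$ arbitrary subsets over each of which $\Pi$ admits a continuous section. -/

import Mathlib

open Set Topology
open scoped unitInterval

namespace ParamTC

/-- A metrisable space `X` is an absolute neighbourhood retract if for every homeomorphism `h` of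
`X` onto a closed subset of a metrisable space `Y` there is an open neighbourhood `U` of `h(X)` in
`Y` which retracts onto `h(X)`. (Letting `Y` range over the universe of `X` loses nothing: `X` is
closed in a convex subset of the normed space of bounded continuous functions on `X`.) -/
def IsANR.{u} (X : Type u) [TopologicalSpace X] : Prop :=
  TopologicalSpace.MetrizableSpace X ∧
    ∀ (Y : Type u) [TopologicalSpace Y] [TopologicalSpace.MetrizableSpace Y] (h : X → Y),
      IsClosedEmbedding h →
        ∃ U : Set Y, IsOpen U ∧ range h ⊆ U ∧
          ∃ r : Y → Y, ContinuousOn r U ∧ MapsTo r U (range h) ∧ ∀ y ∈ range h, r y = y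

/-- `p : E → B` is a locally trivial fibration: every `b` in `B` has an open neighbourhood over
which `p` is homeomorphic to the projection of a product. Over a neighbourhood of `b` the fibre is
then necessarily homeomorphic to `p⁻¹(b)`. -/
def IsLocallyTrivial {E B : Type*} [TopologicalSpace E] [TopologicalSpace B] (p : E → B) : Prop :=
  ∀ b : B, ∃ t : Bundle.Trivialization (p ⁻¹' {b}) p, b ∈ t.baseSet

section Secat

variable {X Y : Type*} [TopologicalSpace X] [TopologicalSpace Y]

/-- `q : X → Y` admits a continuous section over the subset `A` of `Y`. -/
def HasSectionOn (q : C(X, Y)) (A : Set Y) : Prop :=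
  ∃ s : C(A, X), ∀ a : A, q (s a) = a

/-- The sectional category of `q`: the smallest `k` such that `Y` is the union of `k + 1` open
sets over each of which `q` has a continuous section (`⊤` if there is no such `k`). -/
noncomputable def secat (q : C(X, Y)) : ℕ∞ :=
  sInf {n : ℕ∞ | ∃ k : ℕ, n = k ∧ ∃ U : Fin (k + 1) → Set Y,
    (∀ i, IsOpen (U i)) ∧ ⋃ i, U i = univ ∧ ∀ i, HasSectionOn q (U i)}

/-- The analogue of `secat` for covers by `k + 1` arbitrary subsets. -/
noncomputable def secatCover (q : C(X, Y)) : ℕ∞ :=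
  sInf {n : ℕ∞ | ∃ k : ℕ, n = k ∧ ∃ A : Fin (k + 1) → Set Y,
    ⋃ i, A i = univ ∧ ∀ i, HasSectionOn q (A i)}

/-- The generalised sectional category of `q`: the smallest `k` such that `Y` is the disjoint union
of `k + 1` arbitrary subsets over each of which `q` has a continuous section (`⊤` if there is no
such `k`). -/
noncomputable def secatG (q : C(X, Y)) : ℕ∞ :=
  sInf {n : ℕ∞ | ∃ k : ℕ, n = k ∧ ∃ A : Fin (k + 1) → Set Y,
    ⋃ i, A i = univ ∧ Pairwise (fun i j => Disjoint (A i) (A j)) ∧ ∀ i, HasSectionOn q (A i)}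

end Secat

section Param

variable {E B : Type*} [TopologicalSpace E]

/-- The fibre product `E ×_B E`, with the subspace topology from `E × E`. -/
abbrev FibreProd (p : E → B) : Type _ := {e : E × E // p e.1 = p e.2}

/-- The space `E_B^I` of paths in `E` lying in a single fibre of `p`, a subspace of the space of
all paths `C(I, E)` with its compact-open topology. -/
abbrev FibrePaths (p : E → B) : Type _ := {γ : C(I, E) // ∀ s t : I, p (γ s) = p (γ t)}

/-- The endpoint map `Π : E_B^I → E ×_B E`, `γ ↦ (γ 0, γ 1)`. -/
def endpoints (p : E → B) : C(FibrePaths p, FibreProd p) where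
  toFun γ := ⟨(γ.1 0, γ.1 1), γ.2 0 1⟩
  continuous_toFun := by
    refine Continuous.subtype_mk (Continuous.prodMk ?_ ?_) _
    · exact (continuous_eval_const (0 : I)).comp continuous_subtype_val
    · exact (continuous_eval_const (1 : I)).comp continuous_subtype_val

/-- The parametrised topological complexity `TC[p : E → B]`. -/
noncomputable def paramTC (p : E → B) : ℕ∞ := secat (endpoints p)

end Param

end ParamTC

/-! A section of `endpoints p` over an arbitrary set A extends to an open neighbourhood of A
(`exists_isOpen_hasSectionOn`), so arbitrary covers are no better than open ones. For this, E is
embedded as a closed subset of a normed space L. The ANR property gives a neighbourhood retraction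
onto E, which local triviality makes fibrewise over small open sets of B; countably many of these
glue to one R on an open subset of B × L (`exists_embedding_isFibreRetraction`). Near A, the paths
given by the section are averaged in L, corrected linearly to the right endpoints, and pushed back
into the fibres by R. -/

namespace ParamTC

/-! ### Closed embedding of a metrisable space in a normed space -/

section Embedding

open Metric
open scoped ENNReal

/-- The `1`-Lipschitz functions on `E` with values in `[-1, 1]`. -/
abbrev UnitLip (E : Type*) [PseudoMetricSpace E] : Type _ :=
  {f : E → ℝ // LipschitzWith 1 f ∧ ∀ x, |f x| ≤ 1}

variable {E : Type*} [MetricSpace E]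

/-- Evaluation at a point, as a bounded function on `UnitLip E`. -/
def evalLip (x : E) : lp (fun _ : UnitLip E => ℝ) ∞ :=
  ⟨fun f => f.1 x, memℓp_infty ⟨1, by rintro _ ⟨f, rfl⟩; exact f.2.2 x⟩⟩

theorem evalLip_apply (x : E) (f : UnitLip E) : evalLip x f = f.1 x := rfl

theorem lipschitzWith_evalLip : LipschitzWith 1 (evalLip : E → _) := by
  refine LipschitzWith.of_dist_le_mul fun x y => ?_
  rw [dist_eq_norm]
  refine lp.norm_le_of_forall_le (by positivity) fun f => ?_
  have := f.2.1.dist_le_mul x y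
  rwa [Real.dist_eq] at this

/-- The truncated distance to a set. -/
noncomputable def truncInfDist (s : Set E) : UnitLip E :=
  ⟨fun y => min 1 (infDist y s), by
    constructor
    · have := (LipschitzWith.const' (α := E) (1 : ℝ) (K := 0)).min (lipschitz_infDist_pt s)
      simpa using this
    · intro y
      rw [abs_of_nonneg (le_min zero_le_one infDist_nonneg)]
      exact min_le_left _ _⟩

theorem exists_finite_vanishing {u : lp (fun _ : UnitLip E => ℝ) ∞}
    (hu : u ∈ Submodule.span ℝ (range (evalLip : E → _))) :
    ∃ s : Set E, s.Finite ∧ ∀ f : UnitLip E, (∀ x ∈ s, f.1 x = 0) → u f = 0 := by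
  induction hu using Submodule.span_induction with
  | mem u h =>
    obtain ⟨x, rfl⟩ := h
    exact ⟨{x}, finite_singleton x, fun f hf => hf x rfl⟩
  | zero => exact ⟨∅, finite_empty, fun f _ => rfl⟩
  | add u v _ _ hu hv =>
    obtain ⟨s, hs, h⟩ := hu
    obtain ⟨t, ht, h'⟩ := hv
    refine ⟨s ∪ t, hs.union ht, fun f hf => ?_⟩
    rw [lp.coeFn_add, Pi.add_apply, h f fun x hx => hf x (Or.inl hx),
      h' f fun x hx => hf x (Or.inr hx), add_zero]
  | smul c u _ hu =>
    obtain ⟨s, hs, h⟩ := hu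
    refine ⟨s, hs, fun f hf => ?_⟩
    rw [lp.coeFn_smul, Pi.smul_apply, h f hf, smul_zero]

/-- Only finitely many evaluations enter u, so u vanishes on the truncated distance to a finite set.
If `evalLip y` tends to u with y in K, then y must approach that finite set, and so a single point
of it along a subsequence; this point lies in K and evaluates to u. -/
theorem mem_image_evalLip_of_mem_closure {u : lp (fun _ : UnitLip E => ℝ) ∞}
    (hu : u ∈ Submodule.span ℝ (range (evalLip : E → _))) {K : Set E} (hK : IsClosed K)
    (huK : u ∈ closure (evalLip '' K)) : u ∈ evalLip '' K := by
  obtain ⟨s, hs, hsu⟩ := exists_finite_vanishing hu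
  obtain ⟨_, x₀, hx₀, rfl⟩ := closure_nonempty_iff.1 ⟨u, huK⟩
  -- `infDist` to the empty set is 0, so the finite set is made nonempty.
  set s' := insert x₀ s with hs'
  have hfin : s'.Finite := hs.insert x₀
  have hne : s'.Nonempty := insert_nonempty _ _
  have hu0 : u (truncInfDist s') = 0 := by
    refine hsu _ fun x hx => ?_
    simp [truncInfDist, infDist_zero_of_mem (show x ∈ s' from Or.inr hx)]
  by_contra hcon
  have key : ∀ x, ∃ η > 0, ∀ y ∈ K, ‖evalLip y - u‖ < η → η ≤ dist y x := by
    intro x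
    by_cases hx : x ∈ K
    · have hpos : 0 < ‖evalLip x - u‖ := by
        rw [norm_sub_pos_iff]
        rintro rfl
        exact hcon ⟨x, hx, rfl⟩
      refine ⟨_, half_pos hpos, fun y _ hy => ?_⟩
      by_contra! hlt
      have h1 := lipschitzWith_evalLip.dist_le_mul y x
      rw [dist_eq_norm, NNReal.coe_one, one_mul] at h1
      have h2 := norm_sub_le_norm_sub_add_norm_sub (evalLip x) (evalLip y) u
      rw [norm_sub_rev (evalLip x) (evalLip y)] at h2
      linarith
    · obtain ⟨η, hη, hball⟩ := Metric.isOpen_iff.1 hK.isOpen_compl x hx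
      refine ⟨η, hη, fun y hy _ => ?_⟩
      by_contra! hlt
      exact hball hlt hy
  choose η hη key using key
  obtain ⟨x₁, -, hx₁⟩ := hfin.toFinset.exists_min_image η (by simpa using hne)
  obtain ⟨_, ⟨y, hy, rfl⟩, hyu⟩ := Metric.mem_closure_iff.1 huK (min 1 (η x₁))
    (lt_min one_pos (hη x₁))
  rw [dist_comm, dist_eq_norm] at hyu
  obtain ⟨x, hx, hxy⟩ := hfin.isCompact.exists_infDist_eq_dist hne y
  have h1 : η x₁ ≤ η x := hx₁ x (by simpa using hx)
  have h2 := key x y hy (hyu.trans_le ((min_le_right _ _).trans h1))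
  have h3 := lp.norm_apply_le_norm (by simp) (evalLip y - u) (truncInfDist s')
  rw [lp.coeFn_sub, Pi.sub_apply, hu0, sub_zero, evalLip_apply] at h3
  have h4 : min 1 (η x₁) ≤ (truncInfDist s').1 y :=
    min_le_min le_rfl (hxy ▸ h1.trans h2)
  exact absurd ((h4.trans (le_abs_self _)).trans h3) (not_le.2 hyu)

theorem evalLip_injective : Function.Injective (evalLip : E → _) := by
  intro x y h
  have h1 : (truncInfDist {x}).1 x = (truncInfDist {x}).1 y := by
    rw [← evalLip_apply, h, evalLip_apply]
  by_contra hne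
  have h2 : 0 < dist y x := dist_pos.2 (Ne.symm hne)
  simp only [truncInfDist, infDist_singleton, dist_self] at h1
  rw [min_eq_right zero_le_one] at h1
  exact (lt_min one_pos h2).ne h1

end Embedding

/-- A metrisable space is homeomorphic to a closed subset of a normed space. -/
theorem exists_isClosedEmbedding_normedSpace.{u} (E : Type u) [TopologicalSpace E]
    [TopologicalSpace.MetrizableSpace E] :
    ∃ (L : Type u) (_ : NormedAddCommGroup L) (_ : NormedSpace ℝ L) (j : E → L),
      IsClosedEmbedding j := by
  let := TopologicalSpace.metrizableSpaceMetric E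
  let S := Submodule.span ℝ (range (evalLip : E → _))
  have hmem (x : E) : evalLip x ∈ S := Submodule.subset_span ⟨x, rfl⟩
  refine ⟨S, inferInstance, inferInstance, fun x => ⟨evalLip x, hmem x⟩,
    .of_continuous_injective_isClosedMap (lipschitzWith_evalLip.continuous.subtype_mk _)
      (fun x y h => evalLip_injective (congrArg Subtype.val h)) fun K hK => ?_⟩
  refine isClosed_of_closure_subset fun u hu => ?_
  have h1 : u.1 ∈ closure (evalLip '' K) := by
    have := image_closure_subset_closure_image continuous_subtype_val (mem_image_of_mem _ hu)
    rwa [image_image] at this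
  obtain ⟨x, hx, hxu⟩ := mem_image_evalLip_of_mem_closure u.2 hK h1
  exact ⟨x, hx, Subtype.ext hxu⟩

/-! ### Fibrewise neighbourhood retractions and their gluing -/

section FibreRetraction

variable {E B L : Type*} [TopologicalSpace B]

/-- `R` sends the points `(b, v)` of the open set `W` into the image under `j` of the fibre of `p`
over `b`, and fixes the image of every point of `E` lying over `V`. -/
structure IsFibreRetraction [TopologicalSpace L] (p : E → B) (j : E → L) (V : Set B)
    (W : Set (B × L)) (R : B × L → L) : Prop where
  isOpen : IsOpen W
  continuousOn : ContinuousOn R W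
  exists_eq : ∀ z ∈ W, ∃ e, p e = z.1 ∧ j e = R z
  graph_mem : ∀ e, p e ∈ V → (p e, j e) ∈ W
  apply_graph : ∀ e, p e ∈ V → R (p e, j e) = j e

theorem IsLocallyTrivial.continuous [TopologicalSpace E] {p : E → B}
    (hp : IsLocallyTrivial p) : Continuous p := by
  refine continuous_iff_continuousAt.2 fun e => ?_
  obtain ⟨t, ht⟩ := hp (p e)
  exact t.continuousAt_proj (t.mem_source.2 ht)

/-- Over the base of a trivialization, a neighbourhood retraction of `L` onto the closed copy of
`E` can be corrected to preserve the fibres. -/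
theorem exists_isFibreRetraction_trivialization [TopologicalSpace E]
    [TopologicalSpace L] {F : Type*} [TopologicalSpace F] {p : E → B} {j : E → L} (hj : IsEmbedding j) {U : Set L} (hU : IsOpen U)
    (hjU : range j ⊆ U) {r : L → L} (hr : ContinuousOn r U) (hrU : MapsTo r U (range j))
    (hrj : ∀ y ∈ range j, r y = y) (t : Bundle.Trivialization F p) :
    ∃ W R, IsFibreRetraction p j t.baseSet W R := by
  classical
  rcases isEmpty_or_nonempty E with hE | ⟨⟨e₀⟩⟩
  · exact ⟨∅, Prod.snd, isOpen_empty, continuousOn_empty _, fun z hz => hz.elim,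
      fun e => hE.elim e, fun e => hE.elim e⟩
  -- On U, k is the retraction r read in E.
  have hk : ∀ v, ∃ e, v ∈ U → j e = r v := fun v => by
    by_cases hv : v ∈ U
    · obtain ⟨e, he⟩ := hrU hv
      exact ⟨e, fun _ => he⟩
    · exact ⟨e₀, fun h => (hv h).elim⟩
  choose k hk using hk
  have hkj (e : E) : k (j e) = e :=
    hj.injective ((hk _ (hjU ⟨e, rfl⟩)).trans (hrj _ ⟨e, rfl⟩))
  have hkc : ContinuousOn k U := by
    rw [hj.isInducing.continuousOn_iff]
    exact hr.congr fun v hv => hk v hv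
  let O := U ∩ k ⁻¹' t.source
  have hO : IsOpen O := hkc.isOpen_inter_preimage hU t.open_source
  have hmaps (z : B × L) (hz : z ∈ t.baseSet ×ˢ O) : (z.1, (t (k z.2)).2) ∈ t.target :=
    t.mem_target.2 hz.1
  -- Retract v to E, keep only its fibre coordinate in the chart, and put it over the given b.
  refine ⟨t.baseSet ×ˢ O, fun z => j (t.toOpenPartialHomeomorph.symm (z.1, (t (k z.2)).2)),
    t.open_baseSet.prod hO, ?_, fun z hz => ⟨_, t.proj_symm_apply (hmaps z hz), rfl⟩,
    fun e he => ⟨he, hjU ⟨e, rfl⟩, ?_⟩, fun e he => ?_⟩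
  · refine hj.continuous.comp_continuousOn
      (t.toOpenPartialHomeomorph.continuousOn_symm.comp (continuousOn_fst.prodMk ?_) hmaps)
    refine continuous_snd.comp_continuousOn (t.continuousOn_toFun.comp
      (hkc.comp continuousOn_snd fun z hz => hz.2.1) fun z hz => hz.2.2)
  · rw [mem_preimage, hkj]
    exact t.mem_source.2 he
  · simp only [hkj]
    rw [t.symm_apply_mk_proj (t.mem_source.2 he)]

variable [NormedAddCommGroup L] [NormedSpace ℝ L]

/-- The composite of the first `n` of the fibrewise maps
`v ↦ (1 - lam i b) • v + lam i b • R i (b, v)`. -/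
noncomputable def iterRetract (lam : ℕ → B → ℝ) (R : ℕ → B × L → L) : ℕ → B × L → L
  | 0, z => z.2
  | n + 1, z => iterRetract lam R n z +
      lam n z.1 • (R n (z.1, iterRetract lam R n z) - iterRetract lam R n z)

/-- An open set on which `iterRetract lam R n` is continuous, see `continuousOn_iterRetract`. -/
def iterDomain (lam : ℕ → B → ℝ) (W : ℕ → Set (B × L)) (R : ℕ → B × L → L) : ℕ → Set (B × L)
  | 0 => univ
  | n + 1 => {z ∈ iterDomain lam W R n |
      z.1 ∈ tsupport (lam n) → (z.1, iterRetract lam R n z) ∈ W n}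

variable {p : E → B} {j : E → L} {lam : ℕ → B → ℝ} {V : ℕ → Set B} {W : ℕ → Set (B × L)}
  {R : ℕ → B × L → L}

theorem iterRetract_succ_of_eq_zero {B : Type*} {lam : ℕ → B → ℝ} {R : ℕ → B × L → L}
    {n : ℕ} {z : B × L} (h : lam n z.1 = 0) :
    iterRetract lam R (n + 1) z = iterRetract lam R n z := by
  simp [iterRetract, h]

theorem iterRetract_of_forall_eq_zero {B : Type*} {lam : ℕ → B → ℝ} {R : ℕ → B × L → L}
    {m n : ℕ} (hmn : m ≤ n) {z : B × L} (h : ∀ i ≥ m, lam i z.1 = 0) : iterRetract lam R n z = iterRetract lam R m z := by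
  induction n, hmn using Nat.le_induction with
  | base => rfl
  | succ n hn ih => rw [iterRetract_succ_of_eq_zero (h n hn), ih]

theorem iterDomain_antitone : Antitone (iterDomain lam W R) :=
  antitone_nat_of_succ_le fun _ _ hz => hz.1

theorem isOpen_iterDomain_and_continuousOn_iterRetract
    (hR : ∀ n, IsFibreRetraction p j (V n) (W n) (R n)) (hlam : ∀ n, Continuous (lam n)) (n : ℕ) :
    IsOpen (iterDomain lam W R n) ∧ ContinuousOn (iterRetract lam R n) (iterDomain lam W R n) := by
  induction n with
  | zero => exact ⟨isOpen_univ, continuous_snd.continuousOn⟩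
  | succ n ih =>
    obtain ⟨ho, hc⟩ := ih
    have hc' : ContinuousOn (fun z : B × L => (z.1, iterRetract lam R n z)) (iterDomain lam W R n) :=
      continuousOn_fst.prodMk hc
    have hout : IsOpen (iterDomain lam W R n ∩ Prod.fst ⁻¹' (tsupport (lam n))ᶜ) :=
      ho.inter ((isClosed_tsupport _).isOpen_compl.preimage continuous_fst)
    have hin := hc'.isOpen_inter_preimage ho (hR n).isOpen
    -- Using `tsupport` rather than the support makes both pieces open.
    have hdom : iterDomain lam W R (n + 1) =
        (iterDomain lam W R n ∩ Prod.fst ⁻¹' (tsupport (lam n))ᶜ) ∪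
        (iterDomain lam W R n ∩ (fun z : B × L => (z.1, iterRetract lam R n z)) ⁻¹' W n) := by
      ext z
      simp only [iterDomain, mem_ofPred_eq, mem_union, mem_inter_iff, mem_preimage, mem_compl_iff]
      tauto
    refine ⟨hdom ▸ hout.union hin, hdom ▸ ContinuousOn.union_of_isOpen ?_ ?_ hout hin⟩
    · exact (hc.mono inter_subset_left).congr fun z hz =>
        iterRetract_succ_of_eq_zero (image_eq_zero_of_notMem_tsupport hz.2)
    · have h1 := hc.mono (inter_subset_left
        (t := (fun z : B × L => (z.1, iterRetract lam R n z)) ⁻¹' W n))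
      refine h1.add (((hlam n).comp continuous_fst).continuousOn.smul (ContinuousOn.sub ?_ h1))
      exact (hR n).continuousOn.comp (hc'.mono inter_subset_left) fun z hz => hz.2

theorem iterRetract_succ_of_eq (hR : ∀ n, IsFibreRetraction p j (V n) (W n) (R n))
    (hsupp : ∀ n, tsupport (lam n) ⊆ V n) {n : ℕ} {z : B × L} {e : E} (he : p e = z.1)
    (h : iterRetract lam R n z = j e) : iterRetract lam R (n + 1) z = j e := by
  by_cases hz : lam n z.1 = 0
  · rw [iterRetract_succ_of_eq_zero hz, h]
  · have hV : p e ∈ V n := he ▸ hsupp n (subset_tsupport _ hz)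
    simp [iterRetract, h, ← he, (hR n).apply_graph e hV]

theorem iterRetract_of_eq (hR : ∀ n, IsFibreRetraction p j (V n) (W n) (R n))
    (hsupp : ∀ n, tsupport (lam n) ⊆ V n) {m n : ℕ} (hmn : m ≤ n) {z : B × L} {e : E}
    (he : p e = z.1) (h : iterRetract lam R m z = j e) : iterRetract lam R n z = j e := by
  induction n, hmn using Nat.le_induction with
  | base => exact h
  | succ n hn ih => exact iterRetract_succ_of_eq hR hsupp he ih

theorem graph_mem_iterDomain (hR : ∀ n, IsFibreRetraction p j (V n) (W n) (R n))
    (hsupp : ∀ n, tsupport (lam n) ⊆ V n) (e : E) (n : ℕ) :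
    (p e, j e) ∈ iterDomain lam W R n := by
  induction n with
  | zero => trivial
  | succ n ih =>
    refine ⟨ih, fun h => ?_⟩
    rw [iterRetract_of_eq (z := (p e, j e)) hR hsupp n.zero_le rfl rfl]
    exact (hR n).graph_mem e (hsupp n h)

/-- Weight 1 makes step i land in the fibre, and later steps fix points of the fibre. Hence the
gluing uses a bump covering, not a partition of unity. -/
theorem exists_iterRetract_eq (hR : ∀ n, IsFibreRetraction p j (V n) (W n) (R n))
    (hsupp : ∀ n, tsupport (lam n) ⊆ V n) {i n : ℕ} (hin : i < n) {z : B × L}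
    (hz : z ∈ iterDomain lam W R n) (hi : lam i z.1 = 1) :
    ∃ e, p e = z.1 ∧ j e = iterRetract lam R n z := by
  have hz' := (iterDomain_antitone (Nat.succ_le_of_lt hin) hz).2
    (subset_tsupport _ (by simp [hi]))
  obtain ⟨e, he, hje⟩ := (hR i).exists_eq _ hz'
  refine ⟨e, he, (iterRetract_of_eq (z := z) hR hsupp (Nat.succ_le_of_lt hin) he ?_).symm⟩
  simp [iterRetract, hi, hje]

/-- Fibrewise retractions over the members of a countable open cover can be glued. -/
theorem exists_isFibreRetraction_univ [NormalSpace B] [ParacompactSpace B]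
    (hV : ∀ n, IsOpen (V n)) (hVB : ⋃ n, V n = univ)
    (hR : ∀ n, IsFibreRetraction p j (V n) (W n) (R n)) :
    ∃ W R, IsFibreRetraction p j univ W R := by
  obtain ⟨f, hf⟩ := BumpCovering.exists_isSubordinate isClosed_univ V hV hVB.ge
  let lam : ℕ → B → ℝ := fun n => f n
  have hsupp : ∀ n, tsupport (lam n) ⊆ V n := hf
  have hdom := isOpen_iterDomain_and_continuousOn_iterRetract hR fun n => (f n).continuous
  -- Over `N m` the infinite composite stops after m steps; the choice of m below need not be
  -- continuous.
  let N : ℕ → Set B := fun m => interior {b | ∀ i ≥ m, lam i b = 0}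
  have hN {m : ℕ} {b : B} (hb : b ∈ N m) : ∀ i ≥ m, lam i b = 0 := interior_subset hb
  have hNB (b : B) : ∃ m, b ∈ N m := by
    obtain ⟨u, hu, hfin⟩ := f.locallyFinite b
    obtain ⟨m, hm⟩ := hfin.bddAbove
    refine ⟨m + 1, mem_interior_iff_mem_nhds.2 (Filter.mem_of_superset hu fun b' hb' i hi => ?_)⟩
    by_contra h
    exact absurd (hm (show i ∈ _ from ⟨b', h, hb'⟩)) (by omega)
  choose m hm using hNB
  have hS {n : ℕ} {z : B × L} (hz : z.1 ∈ N n) :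
      iterRetract lam R (m z.1) z = iterRetract lam R n z := by
    rcases le_total n (m z.1) with h | h
    · exact iterRetract_of_forall_eq_zero h (hN hz)
    · exact (iterRetract_of_forall_eq_zero h (hN (hm z.1))).symm
  have hop (n : ℕ) : IsOpen (Prod.fst ⁻¹' N n ∩ iterDomain lam W R n) :=
    (isOpen_interior.preimage continuous_fst).inter (hdom n).1
  refine ⟨⋃ n, Prod.fst ⁻¹' N n ∩ iterDomain lam W R n, fun z => iterRetract lam R (m z.1) z,
    isOpen_iUnion hop, ContinuousOn.iUnion_of_isOpen (fun n => ?_) hop, fun z hz => ?_,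
    fun e _ => mem_iUnion.2 ⟨m (p e), hm _, graph_mem_iterDomain hR hsupp e _⟩,
    fun e _ => iterRetract_of_eq (z := (p e, j e)) hR hsupp (Nat.zero_le _) rfl rfl⟩
  · exact ((hdom n).2.mono inter_subset_right).congr fun z hz => hS hz.1
  · obtain ⟨n, hn, hzn⟩ := mem_iUnion.1 hz
    obtain ⟨i, hi⟩ := f.eventuallyEq_one' z.1 (mem_univ _)
    have hi1 : lam i z.1 = 1 := hi.eq_of_nhds
    have hin : i < n := by
      by_contra! h
      exact one_ne_zero (hi1.symm.trans (hN hn i h))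
    simp only [hS hn]
    exact exists_iterRetract_eq hR hsupp hin hzn hi1

/-- A locally trivial fibration of an ANR over a separable metrisable base is a fibrewise
neighbourhood retract of the product of the base with a normed space. -/
theorem exists_embedding_isFibreRetraction.{u} {E : Type u} {B : Type*} [TopologicalSpace E]
    [TopologicalSpace B] [TopologicalSpace.SeparableSpace B] [TopologicalSpace.MetrizableSpace B]
    (hE : IsANR E) {p : E → B} (hp : IsLocallyTrivial p) :
    ∃ (L : Type u) (_ : NormedAddCommGroup L) (_ : NormedSpace ℝ L) (j : E → L)
      (W : Set (B × L)) (R : B × L → L), IsEmbedding j ∧ IsFibreRetraction p j univ W R := by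
  have := hE.1
  obtain ⟨L, _, _, j, hj⟩ := exists_isClosedEmbedding_normedSpace E
  obtain ⟨U, hU, hjU, r, hr, hrU, hrj⟩ := hE.2 L j hj
  refine ⟨L, _, inferInstance, j, ?_⟩
  let := TopologicalSpace.metrizableSpaceMetric B
  have := UniformSpace.secondCountable_of_separable B
  rcases isEmpty_or_nonempty B with hB | hB
  · exact ⟨∅, Prod.snd, hj.isEmbedding, isOpen_empty, continuousOn_empty _, fun z hz => hz.elim,
      fun e => hB.elim (p e), fun e => hB.elim (p e)⟩
  choose t ht using hp
  obtain ⟨s, hs, hsB⟩ := TopologicalSpace.countable_cover_nhds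
    fun b => (t b).open_baseSet.mem_nhds (ht b)
  have hne : s.Nonempty := by
    by_contra! h
    simp [h, empty_ne_univ] at hsB
  obtain ⟨g, rfl⟩ := hs.exists_eq_range hne
  choose W R hR using fun n => exists_isFibreRetraction_trivialization hj.isEmbedding hU hjU hr hrU
    hrj (t (g n))
  obtain ⟨W', R', h⟩ := exists_isFibreRetraction_univ (fun n => (t (g n)).open_baseSet)
    (by simpa using hsB) hR
  exact ⟨W', R', hj.isEmbedding, h⟩

end FibreRetraction

/-! ### Extending sections to open neighbourhoods -/

section Extension

/-- If the radii are chosen with `hδ`, then a convex combination of the `c a` with `x` in the ball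
around `a` of radius `δ a` is controlled by a single one of these `a`. -/
theorem exists_norm_sub_lt_of_mem_convexHull {X M : Type*} [PseudoMetricSpace X]
    [NormedAddCommGroup M] [NormedSpace ℝ M] {A : Set X} {c : A → M} {δ ε : A → ℝ}
    (hδ : ∀ a a' : A, dist a' a < 2 * δ a → ‖c a' - c a‖ < ε a) {x : X} {w : M}
    (hw : w ∈ convexHull ℝ (c '' {a : A | dist x a < δ a})) :
    ∃ a : A, dist x a < δ a ∧ ‖w - c a‖ < ε a := by
  rw [convexHull_eq_union_convexHull_finite_subsets] at hw
  simp only [mem_iUnion] at hw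
  obtain ⟨T, hT, hw⟩ := hw
  have hne : T.Nonempty := by
    rw [← Finset.coe_nonempty, ← convexHull_nonempty_iff (𝕜 := ℝ)]
    exact ⟨w, hw⟩
  have hT' : ∀ u : T, ∃ a : A, dist x a < δ a ∧ c a = u := fun u => hT u.2
  choose α hα hcα using hT'
  -- With the largest radius chosen, all the other centres lie within twice that radius.
  obtain ⟨u, -, hu⟩ := T.attach.exists_max_image (fun u => δ (α u)) (by simpa using hne)
  refine ⟨α u, hα u, ?_⟩
  have hsub : (T : Set M) ⊆ Metric.ball (c (α u)) (ε (α u)) := fun v hv => by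
    have h1 := hα ⟨v, hv⟩
    have h2 := hu ⟨v, hv⟩ (Finset.mem_attach _ _)
    have h3 : dist (α ⟨v, hv⟩) (α u) < 2 * δ (α u) := by
      have := dist_triangle_left (α ⟨v, hv⟩ : X) (α u) x
      have := hα u
      rw [Subtype.dist_eq]
      linarith
    have := hδ _ _ h3
    rw [hcα] at this
    rwa [Metric.mem_ball, dist_eq_norm]
  have := convexHull_min hsub (convex_ball _ _) hw
  rwa [Metric.mem_ball, dist_eq_norm] at this

variable {E B L : Type*} [TopologicalSpace E] [TopologicalSpace B] [NormedAddCommGroup L]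
  [NormedSpace ℝ L] {p : E → B} {j : E → L} {W : Set (B × L)} {R : B × L → L}

/-- The path `β` changed by a linear path so as to have endpoints `u` and `v`. -/
def correctPath (β : I → L) (u v : L) (t : I) : L :=
  β t + (1 - (t : ℝ)) • (u - β 0) + (t : ℝ) • (v - β 1)

/-- The endpoint corrections have norm at most 2ε and convex weights; β itself contributes ε. -/
theorem norm_correctPath_sub_lt {β γ : I → L} {u v : L} {ε : ℝ} (hβ : ∀ t, ‖β t - γ t‖ < ε)
    (hu : ‖u - γ 0‖ < ε) (hv : ‖v - γ 1‖ < ε) (t : I) :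
    ‖correctPath β u v t - γ t‖ < 3 * ε := by
  have h0 : ‖u - β 0‖ ≤ 2 * ε := by
    have := norm_sub_le_norm_sub_add_norm_sub u (γ 0) (β 0)
    rw [norm_sub_rev (γ 0)] at this
    linarith [hβ 0]
  have h1 : ‖v - β 1‖ ≤ 2 * ε := by
    have := norm_sub_le_norm_sub_add_norm_sub v (γ 1) (β 1)
    rw [norm_sub_rev (γ 1)] at this
    linarith [hβ 1]
  have ht0 : 0 ≤ (t : ℝ) := t.2.1
  have ht1 : 0 ≤ 1 - (t : ℝ) := sub_nonneg.2 t.2.2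
  have heq : correctPath β u v t - γ t =
      (β t - γ t) + (1 - (t : ℝ)) • (u - β 0) + (t : ℝ) • (v - β 1) := by
    rw [correctPath]; abel
  calc _ ≤ ‖β t - γ t‖ + (1 - (t : ℝ)) * ‖u - β 0‖ + t * ‖v - β 1‖ := by
        rw [heq]
        refine (norm_add₃_le).trans_eq ?_
        rw [norm_smul, norm_smul, Real.norm_of_nonneg ht0, Real.norm_of_nonneg ht1]
    _ ≤ ‖β t - γ t‖ + (1 - (t : ℝ)) * (2 * ε) + t * (2 * ε) := by gcongr
    _ < 3 * ε := by linarith [hβ t]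

/-- Near a path `γ` in a fibre of `p`, and near its endpoints, paths can be retracted. -/
theorem exists_forall_mem_of_norm_sub_lt {E L : Type*} [NormedAddCommGroup L] {p : E → B}
    {j : E → L} {W : Set (B × L)} {R : B × L → L} (hR : IsFibreRetraction p j univ W R) {b : B}
    {γ : C(I, L)} (hγ : ∀ t, (b, γ t) ∈ W) :
    ∃ ε > 0, ∀ᶠ b' in 𝓝 b, ∀ t v, ‖v - γ t‖ < 3 * ε → (b', v) ∈ W := by
  have hsub : {b} ×ˢ range γ ⊆ W := by
    rintro ⟨_, _⟩ ⟨rfl, t, rfl⟩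
    exact hγ t
  obtain ⟨u, v, hu, hv, hbu, hγv, huv⟩ := generalized_tube_lemma isCompact_singleton
    (isCompact_range γ.continuous) hR.isOpen hsub
  obtain ⟨ε, hε, hth⟩ := (isCompact_range γ.continuous).exists_thickening_subset_open hv hγv
  refine ⟨ε / 3, by positivity, ?_⟩
  filter_upwards [hu.mem_nhds (hbu rfl)] with b' hb' t w hw
  refine huv ⟨hb', hth (Metric.mem_thickening_iff.2 ⟨γ t, ⟨t, rfl⟩, ?_⟩)⟩
  rw [dist_eq_norm]
  linarith

/-- A continuous family of paths in `L`, near fibres of `p`, with prescribed endpoints gives a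
section of the endpoint map. -/
theorem hasSectionOn_of_correctPath_mem (hj : IsEmbedding j)
    (hR : IsFibreRetraction p j univ W R) (hp : Continuous p) {U : Set (FibreProd p)}
    (g : C(U, C(I, L)))
    (hg : ∀ (x : U) t, (p x.1.1.1, correctPath (g x) (j x.1.1.1) (j x.1.1.2) t) ∈ W) :
    HasSectionOn (endpoints p) U := by
  choose e hpe hje using fun (x : U) t => hR.exists_eq _ (hg x t)
  have hec : Continuous fun z : U × I => e z.1 z.2 := by
    rw [hj.isInducing.continuous_iff]
    have hg' (τ : U × I → I) (hτ : Continuous τ) : Continuous fun z : U × I => g z.1 (τ z) :=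
      (g.continuous.comp continuous_fst).eval hτ
    have hz : Continuous fun z : U × I => ((p z.1.1.1.1,
        correctPath (g z.1) (j z.1.1.1.1) (j z.1.1.1.2) z.2) : B × L) := by
      have hjc := hj.continuous
      have h0 := hg' (fun _ => 0) continuous_const
      have h1 := hg' (fun _ => 1) continuous_const
      have ht := hg' Prod.snd continuous_snd
      unfold correctPath
      fun_prop
    exact (hR.continuousOn.comp_continuous hz fun z => hg z.1 z.2).congr
      fun z => (hje z.1 z.2).symm
  let φ : C(U, C(I, E)) := ContinuousMap.curry ⟨fun z : U × I => e z.1 z.2, hec⟩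
  refine ⟨⟨fun x => ⟨φ x, fun s t => (hpe x s).trans (hpe x t).symm⟩,
    φ.continuous.subtype_mk _⟩, fun x => Subtype.ext (Prod.ext ?_ ?_)⟩
  · refine hj.injective ((hje x 0).trans ?_)
    simp [correctPath, hR.apply_graph]
  · refine hj.injective ((hje x 1).trans ?_)
    simp [correctPath, x.1.2, hR.apply_graph]

/-- A section of the endpoint map over an arbitrary set gives one over an open neighbourhood. -/
theorem exists_isOpen_hasSectionOn {E : Type*} [MetricSpace E] {p : E → B} {j : E → L}
    (hj : IsEmbedding j)
    (hR : IsFibreRetraction p j univ W R) (hp : Continuous p) {A : Set (FibreProd p)}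
    (hA : HasSectionOn (endpoints p) A) :
    ∃ U, IsOpen U ∧ A ⊆ U ∧ HasSectionOn (endpoints p) U := by
  obtain ⟨s, hs⟩ := hA
  let c : A → C(I, L) := fun a => (⟨j, hj.continuous⟩ : C(E, L)).comp (s a).1
  have hc : Continuous c :=
    (ContinuousMap.continuous_postcomp _).comp (continuous_subtype_val.comp s.continuous)
  have hs0 (a : A) : (s a).1 0 = a.1.1.1 := congrArg (fun y => y.1.1) (hs a)
  have hs1 (a : A) : (s a).1 1 = a.1.1.2 := congrArg (fun y => y.1.2) (hs a)
  have hloc (a : A) : ∃ ε > 0, ∃ δ > 0, (∀ a' : A, dist a' a < 2 * δ → ‖c a' - c a‖ < ε) ∧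
      ∀ x : FibreProd p, dist x a < δ → ‖j x.1.1 - c a 0‖ < ε ∧ ‖j x.1.2 - c a 1‖ < ε ∧
        ∀ t v, ‖v - c a t‖ < 3 * ε → (p x.1.1, v) ∈ W := by
    have hcW (t : I) : (p a.1.1.1, c a t) ∈ W := by
      have h : p ((s a).1 t) = p a.1.1.1 := by rw [(s a).2 t 0, hs0]
      rw [← h]
      exact hR.graph_mem _ trivial
    obtain ⟨ε, hε, hW⟩ := exists_forall_mem_of_norm_sub_lt hR hcW
    have hc0 : c a 0 = j a.1.1.1 := congrArg j (hs0 a)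
    have hc1 : c a 1 = j a.1.1.2 := congrArg j (hs1 a)
    have hx1 : Continuous fun x : FibreProd p => x.1.1 := continuous_fst.comp continuous_subtype_val
    have hx2 : Continuous fun x : FibreProd p => x.1.2 := continuous_snd.comp continuous_subtype_val
    have e0 : ∀ᶠ x : FibreProd p in 𝓝 a.1, ‖j x.1.1 - c a 0‖ < ε :=
      (((hj.continuous.comp hx1).sub continuous_const).norm.tendsto a.1).eventually_lt_const
        (by simpa [hc0] using hε)
    have e1 : ∀ᶠ x : FibreProd p in 𝓝 a.1, ‖j x.1.2 - c a 1‖ < ε :=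
      (((hj.continuous.comp hx2).sub continuous_const).norm.tendsto a.1).eventually_lt_const
        (by simpa [hc1] using hε)
    have e2 := ((hp.comp hx1).tendsto a.1).eventually hW
    obtain ⟨δ₁, hδ₁, h₁⟩ := Metric.eventually_nhds_iff.1 (e0.and (e1.and e2))
    obtain ⟨δ₂, hδ₂, h₂⟩ := Metric.continuous_iff.1 hc a ε hε
    refine ⟨ε, hε, min δ₁ (δ₂ / 2), by positivity, fun a' ha' => ?_, fun x hx =>
      h₁ (hx.trans_le (min_le_left _ _))⟩
    rw [← dist_eq_norm]
    exact h₂ a' (by linarith [min_le_right δ₁ (δ₂ / 2)])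
  choose ε hε δ hδ hδc hδx using hloc
  let U : Set (FibreProd p) := ⋃ a : A, Metric.ball a.1 (δ a)
  -- Since the balls are open, `c a` remains admissible near each point of the ball around a; a
  -- partition of unity then gives g.
  obtain ⟨g, hg⟩ := exists_continuous_forall_mem_convex_of_local_const (X := U)
    (t := fun x => convexHull ℝ (c '' {a : A | dist x.1 a < δ a}))
    (fun x => convex_convexHull ℝ _) fun x => by
      obtain ⟨a, ha⟩ := mem_iUnion.1 x.2
      refine ⟨c a, ?_⟩
      filter_upwards [(Metric.isOpen_ball.preimage continuous_subtype_val).mem_nhds ha] with y hy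
      exact subset_convexHull ℝ _ ⟨a, hy, rfl⟩
  refine ⟨U, isOpen_iUnion fun a => Metric.isOpen_ball, fun a ha =>
    mem_iUnion.2 ⟨⟨a, ha⟩, Metric.mem_ball_self (hδ _)⟩,
    hasSectionOn_of_correctPath_mem hj hR hp g fun x t => ?_⟩
  obtain ⟨a, hxa, hga⟩ := exists_norm_sub_lt_of_mem_convexHull hδc (hg x)
  obtain ⟨h0, h1, hW⟩ := hδx a x.1 hxa
  refine hW t _ (norm_correctPath_sub_lt (fun t => ?_) h0 h1 t)
  exact ((g x - c a).norm_coe_le_norm t).trans_lt hga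

end Extension

/-! ### Comparison of the three kinds of covers -/

section Covers

variable {X Y : Type*} [TopologicalSpace X] [TopologicalSpace Y] {q : C(X, Y)}

theorem HasSectionOn.mono {A A' : Set Y} (h : HasSectionOn q A) (hA : A' ⊆ A) :
    HasSectionOn q A' := by
  obtain ⟨s, hs⟩ := h
  exact ⟨s.comp ⟨inclusion hA, continuous_inclusion hA⟩, fun a => hs (inclusion hA a)⟩

theorem secat_eq_secatCover (h : ∀ A, HasSectionOn q A → ∃ U, IsOpen U ∧ A ⊆ U ∧ HasSectionOn q U) :
    secat q = secatCover q := by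
  unfold secat secatCover
  congr 1
  ext n
  refine exists_congr fun k => and_congr_right fun _ => ⟨?_, ?_⟩
  · rintro ⟨U, -, hU, hs⟩
    exact ⟨U, hU, hs⟩
  · rintro ⟨A, hA, hs⟩
    choose U hU hAU hUs using fun i => h (A i) (hs i)
    exact ⟨U, hU, eq_univ_of_subset (iUnion_mono hAU) hA, hUs⟩

theorem secatG_eq_secatCover : secatG q = secatCover q := by
  unfold secatG secatCover
  congr 1
  ext n
  refine exists_congr fun k => and_congr_right fun _ => ⟨?_, ?_⟩
  · rintro ⟨A, hA, -, hs⟩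
    exact ⟨A, hA, hs⟩
  · rintro ⟨A, hA, hs⟩
    exact ⟨disjointed A, iUnion_disjointed.trans hA, disjoint_disjointed A,
      fun i => (hs i).mono (disjointed_subset A i)⟩

end Covers

end ParamTC

theorem proposition4p6 {E B : Type*} [TopologicalSpace E] [TopologicalSpace B]
    [TopologicalSpace.SeparableSpace E] [TopologicalSpace.SeparableSpace B]
    (hE : ParamTC.IsANR E) (hB : ParamTC.IsANR B)
    (p : E → B) (hp : ParamTC.IsLocallyTrivial p) :
    ParamTC.paramTC p = ParamTC.secatCover (ParamTC.endpoints p) ∧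
      ParamTC.paramTC p = ParamTC.secatG (ParamTC.endpoints p) := by
  have := hE.1
  have := hB.1
  let := TopologicalSpace.metrizableSpaceMetric E
  obtain ⟨L, _, _, j, W, R, hj, hR⟩ := ParamTC.exists_embedding_isFibreRetraction hE hp
  have h := ParamTC.secat_eq_secatCover fun A hA =>
    ParamTC.exists_isOpen_hasSectionOn hj hR hp.continuous hA
  exact ⟨h, h.trans ParamTC.secatG_eq_secatCover.symm⟩
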